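/- Let $L_2$ be the language of second order arithmetic. Over $\mathsf{RCA}_0$ (basic axioms, $\Sigma^0_1$ induction, $\Delta^0_1$ comprehension), that is, in every model $(M,\mathcal S)$ of $\mathsf{RCA}_0$, where $M$ is a possibly nonstandard number domain and $\mathcal S\subseteq\mathcal P(M)$ is the range of the set variables, the following are equivalent: 1. $\mathsf{ACA}_0$ (basic axioms, the induction axiom, arithmetical comprehension); 2. for every partial order $P$, every strong antichain in $P$ is contained in a maximal strong antichain in $P$; 3. every partial order contains a maximal strong antichain. Here (2) and (3) are read in second order arithmetic: a partial order is a set $P\subseteq\mathbb N$ together with a set $\preceq\ \subseteq P\times P$ (pairs being coded by $(i,j)\mapsto (i+j)^2+i$) that is reflexive, antisymmetric and transitive on $P$; a set $S\subseteq P$ is a strong antichain in $P$ if $(\forall x,y\in S)(\forall z\in P)\,(x\preceq z\wedge y\preceq z\rightarrow x=y)$; and a strong antichain in $P$ is maximal if it is maximal with respect to inclusion among the strong antichains in $P$. -/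

import Mathlib

universe u

namespace SecondOrderArithmetic

/-! ### The language of second order arithmetic and its structures -/

/-- A structure for the language of second order arithmetic (with Henkin semantics): a domain of
numbers with constants `0`, `1`, operations `+`, `*` and a relation `<`, together with a nonempty
collection of subsets of that domain, over which the set variables range.  No law is imposed here;
the number part may be nonstandard and the collection of sets need not be the full power set. -/
structure L2Structure where
  Carrier : Type u
  [instZero : Zero Carrier]
  [instOne : One Carrier]
  [instAdd : Add Carrier]
  [instMul : Mul Carrier]
  [instLT : LT Carrier]
  sets : Set (Set Carrier)
  sets_nonempty : sets.Nonempty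

attribute [instance] L2Structure.instZero L2Structure.instOne L2Structure.instAdd
  L2Structure.instMul L2Structure.instLT

/-- Numerical terms; number variables are de Bruijn indices. -/
inductive NumTerm : Type
  | var (i : ℕ) : NumTerm
  | zero : NumTerm
  | one : NumTerm
  | add (s t : NumTerm) : NumTerm
  | mul (s t : NumTerm) : NumTerm

/-- Move a term under one number quantifier: every variable index is raised by one. -/
def NumTerm.shift : NumTerm → NumTerm
  | var i => var (i + 1)
  | zero => zero
  | one => one
  | add s t => add s.shift t.shift
  | mul s t => mul s.shift t.shift

/-- Arithmetical formulas: the formulas of second order arithmetic without set quantifiers.  Free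
set variables (parameters) are allowed: `mem t j` says that `t` belongs to the `j`-th set variable.
The number quantifiers `all` and `ex` bind the number variable of index `0`. -/
inductive ArithFormula : Type
  | eq (s t : NumTerm) : ArithFormula
  | lt (s t : NumTerm) : ArithFormula
  | mem (t : NumTerm) (j : ℕ) : ArithFormula
  | neg (φ : ArithFormula) : ArithFormula
  | and (φ ψ : ArithFormula) : ArithFormula
  | or (φ ψ : ArithFormula) : ArithFormula
  | imp (φ ψ : ArithFormula) : ArithFormula
  | iff (φ ψ : ArithFormula) : ArithFormula
  | all (φ : ArithFormula) : ArithFormula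
  | ex (φ : ArithFormula) : ArithFormula

namespace ArithFormula

/-- Bounded quantifier formulas: every quantifier has the form `∀ n < t` or `∃ n < t`, where the
bound variable `n` does not occur in the term `t`. -/
inductive IsBounded : ArithFormula → Prop
  | eq (s t : NumTerm) : IsBounded (.eq s t)
  | lt (s t : NumTerm) : IsBounded (.lt s t)
  | mem (t : NumTerm) (j : ℕ) : IsBounded (.mem t j)
  | neg {φ : ArithFormula} : IsBounded φ → IsBounded (.neg φ)
  | and {φ ψ : ArithFormula} : IsBounded φ → IsBounded ψ → IsBounded (.and φ ψ)
  | or {φ ψ : ArithFormula} : IsBounded φ → IsBounded ψ → IsBounded (.or φ ψ)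
  | imp {φ ψ : ArithFormula} : IsBounded φ → IsBounded ψ → IsBounded (.imp φ ψ)
  | iff {φ ψ : ArithFormula} : IsBounded φ → IsBounded ψ → IsBounded (.iff φ ψ)
  | ball (t : NumTerm) {φ : ArithFormula} :
      IsBounded φ → IsBounded (.all (.imp (.lt (.var 0) t.shift) φ))
  | bex (t : NumTerm) {φ : ArithFormula} :
      IsBounded φ → IsBounded (.ex (.and (.lt (.var 0) t.shift) φ))

/-- `Σ⁰₁` formulas: `∃ n θ` with `θ` a bounded quantifier formula. -/
def IsSigma1 (φ : ArithFormula) : Prop := ∃ θ : ArithFormula, θ.IsBounded ∧ φ = .ex θ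

/-- `Π⁰₁` formulas: `∀ n θ` with `θ` a bounded quantifier formula. -/
def IsPi1 (φ : ArithFormula) : Prop := ∃ θ : ArithFormula, θ.IsBounded ∧ φ = .all θ

end ArithFormula

namespace L2Structure

/-- The assignment that gives the value `a` to variable `0` and the value `e i` to variable
`i + 1`. -/
def cons {A : Type u} (a : A) (e : ℕ → A) : ℕ → A
  | 0 => a
  | i + 1 => e i

/-- The value of a term under an assignment `e` of the number variables. -/
def eval (M : L2Structure.{u}) (e : ℕ → M.Carrier) : NumTerm → M.Carrier
  | .var i => e i
  | .zero => 0
  | .one => 1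
  | .add s t => M.eval e s + M.eval e t
  | .mul s t => M.eval e s * M.eval e t

/-- Tarski satisfaction of an arithmetical formula under an assignment `E` of the set variables and
an assignment `e` of the number variables. -/
def Sat (M : L2Structure.{u}) (E : ℕ → Set M.Carrier) : (ℕ → M.Carrier) → ArithFormula → Prop
  | e, .eq s t => M.eval e s = M.eval e t
  | e, .lt s t => M.eval e s < M.eval e t
  | e, .mem t j => M.eval e t ∈ E j
  | e, .neg φ => ¬ M.Sat E e φ
  | e, .and φ ψ => M.Sat E e φ ∧ M.Sat E e ψ
  | e, .or φ ψ => M.Sat E e φ ∨ M.Sat E e ψ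
  | e, .imp φ ψ => M.Sat E e φ → M.Sat E e ψ
  | e, .iff φ ψ => (M.Sat E e φ ↔ M.Sat E e ψ)
  | e, .all φ => ∀ a : M.Carrier, M.Sat E (cons a e) φ
  | e, .ex φ => ∃ a : M.Carrier, M.Sat E (cons a e) φ

/-! ### The axioms of `RCA₀` and `ACA₀`, as properties of a structure

Schemes are read through their universal closures: the number parameters `e` and the set
parameters `E` range over the number domain and over `M.sets`. -/

/-- The basic axioms. -/
structure BasicAxioms (M : L2Structure.{u}) : Prop where
  succ_ne_zero : ∀ n : M.Carrier, n + 1 ≠ 0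
  succ_inj : ∀ m n : M.Carrier, m + 1 = n + 1 → m = n
  add_zero : ∀ m : M.Carrier, m + 0 = m
  add_succ : ∀ m n : M.Carrier, m + (n + 1) = (m + n) + 1
  mul_zero : ∀ m : M.Carrier, m * 0 = 0
  mul_succ : ∀ m n : M.Carrier, m * (n + 1) = m * n + m
  not_lt_zero : ∀ m : M.Carrier, ¬ m < 0
  lt_succ_iff : ∀ m n : M.Carrier, m < n + 1 ↔ (m < n ∨ m = n)

/-- The induction axiom: induction for the sets of the structure. -/
def InductionAxiom (M : L2Structure.{u}) : Prop :=
  ∀ X ∈ M.sets, (0 : M.Carrier) ∈ X → (∀ n ∈ X, n + 1 ∈ X) → ∀ n, n ∈ X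

/-- The `Σ⁰₁` induction scheme. -/
def Sigma1Induction (M : L2Structure.{u}) : Prop :=
  ∀ φ : ArithFormula, φ.IsSigma1 →
    ∀ (E : ℕ → Set M.Carrier) (e : ℕ → M.Carrier), (∀ j, E j ∈ M.sets) →
      M.Sat E (cons 0 e) φ →
      (∀ n, M.Sat E (cons n e) φ → M.Sat E (cons (n + 1) e) φ) →
      ∀ n, M.Sat E (cons n e) φ

/-- The `Δ⁰₁` comprehension scheme. -/
def Delta1Comprehension (M : L2Structure.{u}) : Prop :=
  ∀ φ ψ : ArithFormula, φ.IsSigma1 → ψ.IsPi1 →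
    ∀ (E : ℕ → Set M.Carrier) (e : ℕ → M.Carrier), (∀ j, E j ∈ M.sets) →
      (∀ n, M.Sat E (cons n e) φ ↔ M.Sat E (cons n e) ψ) →
      ∃ X ∈ M.sets, ∀ n, n ∈ X ↔ M.Sat E (cons n e) φ

/-- The arithmetical comprehension scheme. -/
def ArithComprehension (M : L2Structure.{u}) : Prop :=
  ∀ (φ : ArithFormula) (E : ℕ → Set M.Carrier) (e : ℕ → M.Carrier), (∀ j, E j ∈ M.sets) →
    ∃ X ∈ M.sets, ∀ n, n ∈ X ↔ M.Sat E (cons n e) φ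

/-- `M` is a model of `RCA₀`. -/
structure ModelsRCA0 (M : L2Structure.{u}) : Prop where
  basic : M.BasicAxioms
  induction : M.Sigma1Induction
  comprehension : M.Delta1Comprehension

/-- `M` is a model of `ACA₀`. -/
structure ModelsACA0 (M : L2Structure.{u}) : Prop where
  basic : M.BasicAxioms
  induction : M.InductionAxiom
  comprehension : M.ArithComprehension

/-! ### Partial orders and strong antichains inside a structure -/

/-- The usual code `(i + j)² + i` of the ordered pair `(i, j)`. -/
def pair (M : L2Structure.{u}) (i j : M.Carrier) : M.Carrier := (i + j) * (i + j) + i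

/-- `(P, R)` is a partial order in the sense of `M`: both `P` and `R` are sets of `M`, and `R`,
a set of (codes of) pairs of elements of `P`, is reflexive on `P`, antisymmetric and transitive. -/
structure IsPartialOrder (M : L2Structure.{u}) (P R : Set M.Carrier) : Prop where
  carrier_mem : P ∈ M.sets
  rel_mem : R ∈ M.sets
  rel_sub : ∀ c ∈ R, ∃ x ∈ P, ∃ y ∈ P, c = M.pair x y
  refl : ∀ x ∈ P, M.pair x x ∈ R
  antisymm : ∀ x ∈ P, ∀ y ∈ P, M.pair x y ∈ R → M.pair y x ∈ R → x = y
  trans : ∀ x ∈ P, ∀ y ∈ P, ∀ z ∈ P, M.pair x y ∈ R → M.pair y z ∈ R → M.pair x z ∈ R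

/-- `A` is a set of `M` that is a strong antichain in `(P, R)`: its elements are pairwise
incompatible in `P`, that is, no two distinct elements of `A` have a common upper bound in `P`. -/
structure IsStrongAntichain (M : L2Structure.{u}) (P R A : Set M.Carrier) : Prop where
  mem_sets : A ∈ M.sets
  subset : A ⊆ P
  incompatible : ∀ x ∈ A, ∀ y ∈ A, ∀ z ∈ P, M.pair x z ∈ R → M.pair y z ∈ R → x = y

/-- `A` is maximal with respect to inclusion among the strong antichains of `M` in `(P, R)`. -/
structure IsMaximalStrongAntichain (M : L2Structure.{u}) (P R A : Set M.Carrier) : Prop where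
  isStrongAntichain : M.IsStrongAntichain P R A
  maximal : ∀ B : Set M.Carrier, M.IsStrongAntichain P R B → A ⊆ B → B = A

/-- `M` satisfies: every strong antichain in a partial order extends to a maximal strong
antichain. -/
def StrongAntichainExtension (M : L2Structure.{u}) : Prop :=
  ∀ P R : Set M.Carrier, M.IsPartialOrder P R →
    ∀ A : Set M.Carrier, M.IsStrongAntichain P R A →
      ∃ B : Set M.Carrier, A ⊆ B ∧ M.IsMaximalStrongAntichain P R B

/-- `M` satisfies: every partial order contains a maximal strong antichain. -/
def MaximalStrongAntichainExistence (M : L2Structure.{u}) : Prop :=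
  ∀ P R : Set M.Carrier, M.IsPartialOrder P R →
    ∃ B : Set M.Carrier, M.IsMaximalStrongAntichain P R B

end L2Structure

end SecondOrderArithmetic

/-! The three statements are linked through `Sigma1Comprehension`. Over `RCA₀` it is as strong as
arithmetical comprehension: the set defined by a `Σ⁰₁` formula can serve as a set parameter, so
number quantifiers are absorbed one at a time, the remaining free variables being coded into one by
pairing (`IsBoundedDef.ex_of_finite_support`, `IsBoundedDef.sat`).

For (3) → (1), let `p s n` be bounded. Take two points for each `n` and place a common upper bound
over them for every witness `s`. A maximal strong antichain contains both points exactly when there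
is no witness (`exists_witness_iff`), so the `Σ⁰₁` set is computable from the antichain.

For (1) → (2), run through the points incompatible with all of `A` in their numerical order,
accepting each one that is incompatible with those accepted before; these together with `A` form a
maximal strong antichain. Arithmetical comprehension turns compatibility into a set. The recursion
is coded as in Gödel's β function: `m` is accepted if `1 + (m + 1) d` divides `c`, where `d` is a
common multiple that makes these moduli coprime (`exists_isGreedyCode`, `exists_greedy_set`).
Extending the empty antichain gives (2) → (3).

The number domain may be nonstandard, so induction is available only for definable predicates. The
classes `IsTermFn` and `IsBoundedDef` let instance search prove definability of predicates written
as ordinary Lean propositions; the arithmetic needed is then developed from the basic axioms until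
the algebraic and order instances apply. -/

namespace SecondOrderArithmetic

/-! ### Renaming of variables, and dependence on finitely many of them -/

/-- Renaming of the variables of a term. -/
def NumTerm.rename (ρ : ℕ → ℕ) : NumTerm → NumTerm
  | var i => var (ρ i)
  | zero => zero
  | one => one
  | add s t => add (s.rename ρ) (t.rename ρ)
  | mul s t => mul (s.rename ρ) (t.rename ρ)

/-- A renaming, moved under one number quantifier. -/
def liftRenaming (ρ : ℕ → ℕ) : ℕ → ℕ
  | 0 => 0
  | i + 1 => ρ i + 1

theorem NumTerm.rename_shift (ρ : ℕ → ℕ) (t : NumTerm) :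
    t.shift.rename (liftRenaming ρ) = (t.rename ρ).shift := by
  induction t with
  | var i => rfl
  | zero => rfl
  | one => rfl
  | add s t hs ht => simp [shift, rename, hs, ht]
  | mul s t hs ht => simp [shift, rename, hs, ht]

/-- Simultaneous renaming of the free number variables and of the set variables. -/
def ArithFormula.rename (σ : ℕ → ℕ) : (ℕ → ℕ) → ArithFormula → ArithFormula
  | ρ, eq s t => eq (s.rename ρ) (t.rename ρ)
  | ρ, lt s t => lt (s.rename ρ) (t.rename ρ)
  | ρ, mem t j => mem (t.rename ρ) (σ j)
  | ρ, neg φ => neg (φ.rename σ ρ)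
  | ρ, and φ ψ => and (φ.rename σ ρ) (ψ.rename σ ρ)
  | ρ, or φ ψ => or (φ.rename σ ρ) (ψ.rename σ ρ)
  | ρ, imp φ ψ => imp (φ.rename σ ρ) (ψ.rename σ ρ)
  | ρ, iff φ ψ => iff (φ.rename σ ρ) (ψ.rename σ ρ)
  | ρ, all φ => all (φ.rename σ (liftRenaming ρ))
  | ρ, ex φ => ex (φ.rename σ (liftRenaming ρ))

theorem ArithFormula.IsBounded.rename {φ : ArithFormula} (h : φ.IsBounded) (σ ρ : ℕ → ℕ) :
    (φ.rename σ ρ).IsBounded := by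
  induction h generalizing ρ with
  | eq s t => exact .eq _ _
  | lt s t => exact .lt _ _
  | mem t j => exact .mem _ _
  | neg _ h => exact .neg (h ρ)
  | and _ _ h h' => exact .and (h ρ) (h' ρ)
  | or _ _ h h' => exact .or (h ρ) (h' ρ)
  | imp _ _ h h' => exact .imp (h ρ) (h' ρ)
  | iff _ _ h h' => exact .iff (h ρ) (h' ρ)
  | ball t _ h =>
    simp only [ArithFormula.rename, NumTerm.rename_shift]
    exact .ball _ (h _)
  | bex t _ h =>
    simp only [ArithFormula.rename, NumTerm.rename_shift]
    exact .bex _ (h _)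

namespace L2Structure

variable {M : L2Structure.{u}}

theorem cons_eta {A : Type u} (e : ℕ → A) : cons (e 0) (fun i => e (i + 1)) = e := by
  funext i
  cases i <;> rfl

theorem cons_comp_liftRenaming {A : Type u} (a : A) (e : ℕ → A) (ρ : ℕ → ℕ) :
    cons a e ∘ liftRenaming ρ = cons a (e ∘ ρ) := by
  funext i
  cases i <;> rfl

theorem eval_shift (a : M.Carrier) (e : ℕ → M.Carrier) (t : NumTerm) :
    M.eval (cons a e) t.shift = M.eval e t := by
  induction t with
  | var i => rfl
  | zero => rfl
  | one => rfl
  | add s t hs ht => simp [NumTerm.shift, eval, hs, ht]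
  | mul s t hs ht => simp [NumTerm.shift, eval, hs, ht]

theorem eval_rename (e : ℕ → M.Carrier) (ρ : ℕ → ℕ) (t : NumTerm) :
    M.eval e (t.rename ρ) = M.eval (e ∘ ρ) t := by
  induction t with
  | var i => rfl
  | zero => rfl
  | one => rfl
  | add s t hs ht => simp [NumTerm.rename, eval, hs, ht]
  | mul s t hs ht => simp [NumTerm.rename, eval, hs, ht]

/-- The substitution lemma; with it two formulas can be moved to disjoint variables and read under
one common assignment. -/
theorem sat_rename (E : ℕ → Set M.Carrier) (σ : ℕ → ℕ) (φ : ArithFormula) (e : ℕ → M.Carrier)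
    (ρ : ℕ → ℕ) : M.Sat E e (φ.rename σ ρ) ↔ M.Sat (E ∘ σ) (e ∘ ρ) φ := by
  induction φ generalizing e ρ with
  | eq s t => simp [ArithFormula.rename, Sat, eval_rename]
  | lt s t => simp [ArithFormula.rename, Sat, eval_rename]
  | mem t j => simp [ArithFormula.rename, Sat, eval_rename]
  | neg φ h => simp [ArithFormula.rename, Sat, h]
  | and φ ψ h h' => simp [ArithFormula.rename, Sat, h, h']
  | or φ ψ h h' => simp [ArithFormula.rename, Sat, h, h']
  | imp φ ψ h h' => simp [ArithFormula.rename, Sat, h, h']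
  | iff φ ψ h h' => simp [ArithFormula.rename, Sat, h, h']
  | all φ h => simp [ArithFormula.rename, Sat, h, cons_comp_liftRenaming]
  | ex φ h => simp [ArithFormula.rename, Sat, h, cons_comp_liftRenaming]

/-- A value depends on finitely many variables only. -/
theorem eval_finite_support (t : NumTerm) : ∃ k : ℕ, ∀ e e' : ℕ → M.Carrier,
    (∀ i < k, e i = e' i) → M.eval e t = M.eval e' t := by
  induction t with
  | var i => exact ⟨i + 1, fun e e' h => h i (Nat.lt_succ_self i)⟩
  | zero => exact ⟨0, fun _ _ _ => rfl⟩
  | one => exact ⟨0, fun _ _ _ => rfl⟩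
  | add s t hs ht =>
    obtain ⟨k, hk⟩ := hs
    obtain ⟨l, hl⟩ := ht
    refine ⟨max k l, fun e e' h => ?_⟩
    rw [eval, eval, hk e e' fun i hi => h i (by omega), hl e e' fun i hi => h i (by omega)]
  | mul s t hs ht =>
    obtain ⟨k, hk⟩ := hs
    obtain ⟨l, hl⟩ := ht
    refine ⟨max k l, fun e e' h => ?_⟩
    rw [eval, eval, hk e e' fun i hi => h i (by omega), hl e e' fun i hi => h i (by omega)]

theorem cons_agree {A : Type u} {e e' : ℕ → A} {k : ℕ} (h : ∀ i < k, e i = e' i) (a : A) :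
    ∀ i < k + 1, cons a e i = cons a e' i
  | 0, _ => rfl
  | i + 1, hi => h i (by omega)

/-- Truth depends on finitely many variables only. -/
theorem sat_finite_support (E : ℕ → Set M.Carrier) (φ : ArithFormula) :
    ∃ k : ℕ, ∀ e e' : ℕ → M.Carrier,
      (∀ i < k, e i = e' i) → (M.Sat E e φ ↔ M.Sat E e' φ) := by
  have binary : ∀ {p q : (ℕ → M.Carrier) → Prop},
      (∃ k : ℕ, ∀ e e' : ℕ → M.Carrier, (∀ i < k, e i = e' i) → (p e ↔ p e')) →
      (∃ k : ℕ, ∀ e e' : ℕ → M.Carrier, (∀ i < k, e i = e' i) → (q e ↔ q e')) →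
      ∃ k : ℕ, ∀ e e' : ℕ → M.Carrier, (∀ i < k, e i = e' i) →
        (p e ↔ p e') ∧ (q e ↔ q e') := by
    rintro p q ⟨k, hk⟩ ⟨l, hl⟩
    exact ⟨max k l, fun e e' h =>
      ⟨hk e e' fun i hi => h i (by omega), hl e e' fun i hi => h i (by omega)⟩⟩
  induction φ with
  | eq s t =>
    obtain ⟨k, hk⟩ := eval_finite_support (M := M) s
    obtain ⟨l, hl⟩ := eval_finite_support (M := M) t
    refine ⟨max k l, fun e e' h => ?_⟩
    rw [Sat, Sat, hk e e' fun i hi => h i (by omega), hl e e' fun i hi => h i (by omega)]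
  | lt s t =>
    obtain ⟨k, hk⟩ := eval_finite_support (M := M) s
    obtain ⟨l, hl⟩ := eval_finite_support (M := M) t
    refine ⟨max k l, fun e e' h => ?_⟩
    rw [Sat, Sat, hk e e' fun i hi => h i (by omega), hl e e' fun i hi => h i (by omega)]
  | mem t j =>
    obtain ⟨k, hk⟩ := eval_finite_support (M := M) t
    exact ⟨k, fun e e' h => by rw [Sat, Sat, hk e e' h]⟩
  | neg φ h =>
    obtain ⟨k, hk⟩ := h
    exact ⟨k, fun e e' h => not_congr (hk e e' h)⟩
  | and φ ψ h h' =>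
    obtain ⟨k, hk⟩ := binary h h'
    exact ⟨k, fun e e' h => and_congr (hk e e' h).1 (hk e e' h).2⟩
  | or φ ψ h h' =>
    obtain ⟨k, hk⟩ := binary h h'
    exact ⟨k, fun e e' h => or_congr (hk e e' h).1 (hk e e' h).2⟩
  | imp φ ψ h h' =>
    obtain ⟨k, hk⟩ := binary h h'
    exact ⟨k, fun e e' h => imp_congr (hk e e' h).1 (hk e e' h).2⟩
  | iff φ ψ h h' =>
    obtain ⟨k, hk⟩ := binary h h'
    exact ⟨k, fun e e' h => iff_congr (hk e e' h).1 (hk e e' h).2⟩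
  | all φ h =>
    obtain ⟨k, hk⟩ := h
    exact ⟨k, fun e e' h =>
      forall_congr' fun a => hk _ _ fun i hi => cons_agree h a i (by omega)⟩
  | ex φ h =>
    obtain ⟨k, hk⟩ := h
    exact ⟨k, fun e e' h =>
      exists_congr fun a => hk _ _ fun i hi => cons_agree h a i (by omega)⟩

/-! ### Predicates definable by bounded formulas with parameters -/

/-- The assignment whose `i`-th value is a variable of `e` or a constant, as prescribed by `r`. -/
def subst (r : ℕ → ℕ ⊕ M.Carrier) (e : ℕ → M.Carrier) (i : ℕ) : M.Carrier := Sum.elim e id (r i)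

/-- A function of the number variables that is given by a term with number parameters. -/
class IsTermFn (f : (ℕ → M.Carrier) → M.Carrier) : Prop where
  out : ∃ (t : NumTerm) (r : ℕ → ℕ ⊕ M.Carrier), ∀ e, f e = M.eval (subst r e) t

/-- A predicate of the number variables that is defined by a bounded quantifier formula with
number parameters and set parameters. -/
class IsBoundedDef (p : (ℕ → M.Carrier) → Prop) : Prop where
  out : ∃ (φ : ArithFormula) (E : ℕ → Set M.Carrier) (r : ℕ → ℕ ⊕ M.Carrier), φ.IsBounded ∧
    (∀ j, E j ∈ M.sets) ∧ ∀ e, p e ↔ M.Sat E (subst r e) φ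

/-- Two sequences merged into one. -/
def merge {A : Type u} (f g : ℕ → A) (i : ℕ) : A := Sum.elim f g (Equiv.natSumNatEquivNat.symm i)

/-- The positions of the first sequence in a merged one. -/
def mergeLeft (i : ℕ) : ℕ := Equiv.natSumNatEquivNat (.inl i)

/-- The positions of the second sequence in a merged one. -/
def mergeRight (i : ℕ) : ℕ := Equiv.natSumNatEquivNat (.inr i)

theorem merge_comp_left {A : Type u} (f g : ℕ → A) : merge f g ∘ mergeLeft = f := by
  funext i
  simp only [merge, mergeLeft, Function.comp_apply, Equiv.symm_apply_apply, Sum.elim_inl]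

theorem merge_comp_right {A : Type u} (f g : ℕ → A) : merge f g ∘ mergeRight = g := by
  funext i
  simp only [merge, mergeRight, Function.comp_apply, Equiv.symm_apply_apply, Sum.elim_inr]

theorem subst_comp (r : ℕ → ℕ ⊕ M.Carrier) (e : ℕ → M.Carrier) (ρ : ℕ → ℕ) :
    subst r e ∘ ρ = subst (r ∘ ρ) e := rfl

/-- The two terms may use different parameters. Renaming them to disjoint sets of variables lets one
merged assignment serve both, which every binary closure property needs. -/
theorem IsTermFn.common (f g : (ℕ → M.Carrier) → M.Carrier) [hf : IsTermFn f] [hg : IsTermFn g] :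
    ∃ (s t : NumTerm) (r : ℕ → ℕ ⊕ M.Carrier),
      (∀ e, f e = M.eval (subst r e) s) ∧ ∀ e, g e = M.eval (subst r e) t := by
  obtain ⟨s, r, hs⟩ := hf.out
  obtain ⟨t, r', ht⟩ := hg.out
  refine ⟨s.rename mergeLeft, t.rename mergeRight, merge r r', fun e => ?_, fun e => ?_⟩
  · rw [eval_rename, subst_comp, merge_comp_left, hs]
  · rw [eval_rename, subst_comp, merge_comp_right, ht]

theorem merge_mem {E E' : ℕ → Set M.Carrier} (h : ∀ j, E j ∈ M.sets) (h' : ∀ j, E' j ∈ M.sets)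
    (j : ℕ) : merge E E' j ∈ M.sets := by
  unfold merge
  cases Equiv.natSumNatEquivNat.symm j with
  | inl i => exact h i
  | inr i => exact h' i

theorem IsBoundedDef.common (p q : (ℕ → M.Carrier) → Prop) [hp : IsBoundedDef p]
    [hq : IsBoundedDef q] :
    ∃ (φ ψ : ArithFormula) (E : ℕ → Set M.Carrier) (r : ℕ → ℕ ⊕ M.Carrier), φ.IsBounded ∧
      ψ.IsBounded ∧ (∀ j, E j ∈ M.sets) ∧ (∀ e, p e ↔ M.Sat E (subst r e) φ) ∧
      ∀ e, q e ↔ M.Sat E (subst r e) ψ := by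
  obtain ⟨φ, E, r, hφ, hE, h⟩ := hp.out
  obtain ⟨ψ, E', r', hψ, hE', h'⟩ := hq.out
  refine ⟨φ.rename mergeLeft mergeLeft, ψ.rename mergeRight mergeRight, merge E E', merge r r',
    hφ.rename _ _, hψ.rename _ _, merge_mem hE hE', fun e => ?_, fun e => ?_⟩
  · rw [sat_rename, subst_comp, merge_comp_left, merge_comp_left, h]
  · rw [sat_rename, subst_comp, merge_comp_right, merge_comp_right, h']

theorem IsBoundedDef.finite_support (p : (ℕ → M.Carrier) → Prop) [hp : IsBoundedDef p] :
    ∃ k : ℕ, ∀ e e' : ℕ → M.Carrier, (∀ i < k, e i = e' i) → (p e ↔ p e') := by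
  obtain ⟨φ, E, r, -, -, h⟩ := hp.out
  obtain ⟨k, hk⟩ := sat_finite_support E φ
  -- The formula reads its first `k` variables only; each contributes a strict bound `j + 1` if it
  -- stands for variable `j`, and `0` if it is a constant.
  refine ⟨(Finset.range k).sup (fun i => Sum.elim (fun j => j + 1) (fun _ => 0) (r i)),
    fun e e' he => ?_⟩
  rw [h, h]
  refine hk _ _ fun i hi => ?_
  have hle := Finset.le_sup (f := fun i => Sum.elim (fun j => j + 1) (fun _ => 0) (r i))
    (Finset.mem_range.2 hi)
  unfold subst
  cases hr : r i with
  | inl j =>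
    refine he j ?_
    simp only [hr, Sum.elim_inl] at hle
    omega
  | inr c => rfl

/-! ### Closure properties of definability, as instances -/

instance IsTermFn.var (i : ℕ) : IsTermFn (M := M) (fun e => e i) :=
  ⟨.var i, .inl, fun _ => rfl⟩

instance IsTermFn.const (c : M.Carrier) : IsTermFn (M := M) (fun _ => c) :=
  ⟨.var 0, fun _ => .inr c, fun _ => rfl⟩

instance IsTermFn.add (f g : (ℕ → M.Carrier) → M.Carrier) [IsTermFn f] [IsTermFn g] :
    IsTermFn (fun e => f e + g e) := by
  obtain ⟨s, t, r, hs, ht⟩ := IsTermFn.common f g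
  exact ⟨.add s t, r, fun e => by rw [hs, ht, eval]⟩

instance IsTermFn.mul (f g : (ℕ → M.Carrier) → M.Carrier) [IsTermFn f] [IsTermFn g] :
    IsTermFn (fun e => f e * g e) := by
  obtain ⟨s, t, r, hs, ht⟩ := IsTermFn.common f g
  exact ⟨.mul s t, r, fun e => by rw [hs, ht, eval]⟩

instance IsTermFn.pair (f g : (ℕ → M.Carrier) → M.Carrier) [IsTermFn f] [IsTermFn g] :
    IsTermFn (fun e => M.pair (f e) (g e)) :=
  inferInstanceAs (IsTermFn (fun e => (f e + g e) * (f e + g e) + f e))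

instance IsBoundedDef.eq (f g : (ℕ → M.Carrier) → M.Carrier) [IsTermFn f] [IsTermFn g] :
    IsBoundedDef (fun e => f e = g e) := by
  obtain ⟨s, t, r, hs, ht⟩ := IsTermFn.common f g
  -- No set variable occurs, but the set assignment must take values in `M.sets`; any member fills
  -- it.
  obtain ⟨X, hX⟩ := M.sets_nonempty
  exact ⟨.eq s t, fun _ => X, r, .eq _ _, fun _ => hX, fun e => by rw [hs, ht, Sat]⟩

instance IsBoundedDef.lt (f g : (ℕ → M.Carrier) → M.Carrier) [IsTermFn f] [IsTermFn g] :
    IsBoundedDef (fun e => f e < g e) := by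
  obtain ⟨s, t, r, hs, ht⟩ := IsTermFn.common f g
  obtain ⟨X, hX⟩ := M.sets_nonempty
  exact ⟨.lt s t, fun _ => X, r, .lt _ _, fun _ => hX, fun e => by rw [hs, ht, Sat]⟩

instance IsBoundedDef.mem (f : (ℕ → M.Carrier) → M.Carrier) (X : Set M.Carrier) [hf : IsTermFn f]
    [hX : Fact (X ∈ M.sets)] : IsBoundedDef (fun e => f e ∈ X) := by
  obtain ⟨t, r, ht⟩ := hf.out
  exact ⟨.mem t 0, fun _ => X, r, .mem _ _, fun _ => hX.out, fun e => by rw [ht, Sat]⟩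

instance IsBoundedDef.const (P : Prop) : IsBoundedDef (M := M) (fun _ => P) := by
  obtain ⟨X, hX⟩ := M.sets_nonempty
  by_cases hP : P
  · exact ⟨.eq .zero .zero, fun _ => X, .inl, .eq _ _, fun _ => hX, fun e => by simp [Sat, hP]⟩
  · exact ⟨.neg (.eq .zero .zero), fun _ => X, .inl, .neg (.eq _ _), fun _ => hX,
      fun e => by simp [Sat, hP]⟩

instance IsBoundedDef.not (p : (ℕ → M.Carrier) → Prop) [hp : IsBoundedDef p] :
    IsBoundedDef (fun e => ¬ p e) := by
  obtain ⟨φ, E, r, hφ, hE, h⟩ := hp.out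
  exact ⟨.neg φ, E, r, .neg hφ, hE, fun e => by rw [h, Sat]⟩

instance IsBoundedDef.and (p q : (ℕ → M.Carrier) → Prop) [IsBoundedDef p] [IsBoundedDef q] :
    IsBoundedDef (fun e => p e ∧ q e) := by
  obtain ⟨φ, ψ, E, r, hφ, hψ, hE, h, h'⟩ := IsBoundedDef.common p q
  exact ⟨.and φ ψ, E, r, .and hφ hψ, hE, fun e => by rw [h, h', Sat]⟩

instance IsBoundedDef.or (p q : (ℕ → M.Carrier) → Prop) [IsBoundedDef p] [IsBoundedDef q] :
    IsBoundedDef (fun e => p e ∨ q e) := by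
  obtain ⟨φ, ψ, E, r, hφ, hψ, hE, h, h'⟩ := IsBoundedDef.common p q
  exact ⟨.or φ ψ, E, r, .or hφ hψ, hE, fun e => by rw [h, h', Sat]⟩

instance IsBoundedDef.imp (p q : (ℕ → M.Carrier) → Prop) [IsBoundedDef p] [IsBoundedDef q] :
    IsBoundedDef (fun e => p e → q e) := by
  obtain ⟨φ, ψ, E, r, hφ, hψ, hE, h, h'⟩ := IsBoundedDef.common p q
  exact ⟨.imp φ ψ, E, r, .imp hφ hψ, hE, fun e => by rw [h, h', Sat]⟩

instance IsBoundedDef.iff (p q : (ℕ → M.Carrier) → Prop) [IsBoundedDef p] [IsBoundedDef q] :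
    IsBoundedDef (fun e => p e ↔ q e) := by
  obtain ⟨φ, ψ, E, r, hφ, hψ, hE, h, h'⟩ := IsBoundedDef.common p q
  exact ⟨.iff φ ψ, E, r, .iff hφ hψ, hE, fun e => by rw [h, h', Sat]⟩

/-- The definition of a predicate with a distinguished variable `0`. -/
theorem IsBoundedDef.distinguish (q : M.Carrier → (ℕ → M.Carrier) → Prop)
    [hq : IsBoundedDef (fun e => q (e 0) (fun i => e (i + 1)))] :
    ∃ (φ : ArithFormula) (E : ℕ → Set M.Carrier) (r : ℕ → ℕ ⊕ M.Carrier), φ.IsBounded ∧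
      (∀ j, E j ∈ M.sets) ∧ ∀ a e, q a e ↔ M.Sat E (cons a (subst r e)) φ := by
  obtain ⟨φ, E, r, hφ, hE, h⟩ := hq.out
  -- Formula variables that stand for variable `0` are merged into the new variable `0`, and all
  -- others move up by one. The value `.inl 0` in the new assignment is a dummy that is never read.
  refine ⟨φ.rename id (fun i => match r i with | .inl 0 => 0 | _ => i + 1), E,
    fun i => match r i with | .inl 0 => .inl 0 | .inl (j + 1) => .inl j | .inr c => .inr c,
    hφ.rename _ _, hE, fun a e => ?_⟩
  rw [sat_rename]
  refine (h (cons a e)).trans (iff_of_eq ?_)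
  congr 1
  funext i
  simp only [subst, Function.comp_apply]
  match hr : r i with
  | .inl 0 => rfl
  | .inl (j + 1) => simp [cons, subst, hr]
  | .inr c => simp [cons, subst, hr]

theorem IsBoundedDef.distinguish_with_term (t : (ℕ → M.Carrier) → M.Carrier)
    (q : M.Carrier → (ℕ → M.Carrier) → Prop) [ht : IsTermFn t]
    [IsBoundedDef (fun e => q (e 0) (fun i => e (i + 1)))] :
    ∃ (s : NumTerm) (φ : ArithFormula) (E : ℕ → Set M.Carrier) (r : ℕ → ℕ ⊕ M.Carrier),
      φ.IsBounded ∧ (∀ j, E j ∈ M.sets) ∧ (∀ e, t e = M.eval (subst r e) s) ∧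
      ∀ a e, q a e ↔ M.Sat E (cons a (subst r e)) φ := by
  obtain ⟨s, r, hs⟩ := ht.out
  obtain ⟨φ, E, r', hφ, hE, h⟩ := IsBoundedDef.distinguish q
  refine ⟨s.rename mergeLeft, φ.rename id (liftRenaming mergeRight), E, merge r r',
    hφ.rename _ _, hE, fun e => ?_, fun a e => ?_⟩
  · rw [eval_rename, subst_comp, merge_comp_left, hs]
  · rw [sat_rename, cons_comp_liftRenaming, subst_comp, merge_comp_right, h]
    rfl

instance IsBoundedDef.ball (t : (ℕ → M.Carrier) → M.Carrier)
    (q : M.Carrier → (ℕ → M.Carrier) → Prop) [IsTermFn t]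
    [IsBoundedDef (fun e => q (e 0) (fun i => e (i + 1)))] :
    IsBoundedDef (fun e => ∀ a, a < t e → q a e) := by
  obtain ⟨s, φ, E, r, hφ, hE, hs, h⟩ := IsBoundedDef.distinguish_with_term t q
  refine ⟨_, E, r, .ball s hφ, hE, fun e => ?_⟩
  simp only [Sat, eval_shift, h, hs, eval, cons]

instance IsBoundedDef.bex (t : (ℕ → M.Carrier) → M.Carrier)
    (q : M.Carrier → (ℕ → M.Carrier) → Prop) [IsTermFn t]
    [IsBoundedDef (fun e => q (e 0) (fun i => e (i + 1)))] :
    IsBoundedDef (fun e => ∃ a, a < t e ∧ q a e) := by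
  obtain ⟨s, φ, E, r, hφ, hE, hs, h⟩ := IsBoundedDef.distinguish_with_term t q
  refine ⟨_, E, r, .bex s hφ, hE, fun e => ?_⟩
  simp only [Sat, eval_shift, h, hs, eval, cons]

/-- Definability is preserved by replacing variables by variables and constants. -/
theorem IsBoundedDef.comp (p : (ℕ → M.Carrier) → Prop) [hp : IsBoundedDef p]
    (r : ℕ → ℕ ⊕ M.Carrier) : IsBoundedDef (fun e => p (subst r e)) := by
  obtain ⟨φ, E, r', hφ, hE, h⟩ := hp.out
  refine ⟨φ, E, fun i => Sum.elim r .inr (r' i), hφ, hE, fun e => ?_⟩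
  refine (h _).trans (iff_of_eq ?_)
  congr 1
  funext i
  simp only [subst]
  cases r' i <;> rfl

theorem IsTermFn.shift (f : (ℕ → M.Carrier) → M.Carrier) [hf : IsTermFn f] :
    IsTermFn (fun e => f (fun i => e (i + 1))) := by
  obtain ⟨t, r, ht⟩ := hf.out
  refine ⟨t, fun i => Sum.map (· + 1) id (r i), fun e => (ht _).trans ?_⟩
  congr 1
  funext i
  simp only [L2Structure.subst]
  cases r i <;> rfl

theorem IsBoundedDef.congr {p q : (ℕ → M.Carrier) → Prop} (hp : IsBoundedDef p)
    (h : ∀ e, p e ↔ q e) : IsBoundedDef q := by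
  rwa [show q = p from funext fun e => propext (h e).symm]

/-! ### The axiom schemes for definable predicates -/

/-- The definition of a binary predicate, in the form used by the axiom schemes. -/
theorem IsBoundedDef.binary (p : M.Carrier → M.Carrier → Prop)
    [hp : IsBoundedDef (fun e => p (e 0) (e 1))] :
    ∃ (φ : ArithFormula) (E : ℕ → Set M.Carrier) (e : ℕ → M.Carrier), φ.IsBounded ∧
      (∀ j, E j ∈ M.sets) ∧ ∀ a b, p a b ↔ M.Sat E (cons a (cons b e)) φ := by
  obtain ⟨φ, E, r, hφ, hE, h⟩ := hp.out
  -- Only the first two variables matter, so every variable after `0` may take the value `b`.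
  -- Constants become number parameters, behind the two distinguished places; the value `0` is a
  -- filler.
  refine ⟨φ.rename id (fun i => match r i with | .inl 0 => 0 | .inl _ => 1 | .inr _ => i + 2), E,
    fun i => match r i with | .inl _ => 0 | .inr c => c, hφ.rename _ _, hE, fun a b => ?_⟩
  rw [sat_rename]
  refine (h (cons a fun _ => b)).trans (iff_of_eq ?_)
  congr 1
  funext i
  simp only [subst, Function.comp_apply]
  match hr : r i with
  | .inl 0 => rfl
  | .inl (j + 1) => rfl
  | .inr c => simp [cons, hr]

theorem sigma1_induction (hI : M.Sigma1Induction) (p : M.Carrier → M.Carrier → Prop)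
    [IsBoundedDef (fun e => p (e 0) (e 1))] (zero : ∃ a, p a 0)
    (succ : ∀ n, (∃ a, p a n) → ∃ a, p a (n + 1)) (n : M.Carrier) : ∃ a, p a n := by
  obtain ⟨φ, E, e, hφ, hE, h⟩ := IsBoundedDef.binary p
  simp only [h] at zero succ ⊢
  exact hI (.ex φ) ⟨φ, hφ, rfl⟩ E e hE zero succ n

theorem bounded_induction (hI : M.Sigma1Induction) (p : M.Carrier → Prop)
    [IsBoundedDef (fun e => p (e 0))] (zero : p 0) (succ : ∀ n, p n → p (n + 1)) (n : M.Carrier) :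
    p n := by
  have : IsBoundedDef (M := M) (fun e => (fun _ b => p b) (e 0) (e 1)) :=
    IsBoundedDef.comp (fun e => p (e 0)) (fun _ => .inl 1)
  obtain ⟨_, h⟩ := sigma1_induction hI (fun _ b => p b) ⟨0, zero⟩
    (fun n ⟨_, h⟩ => ⟨0, succ n h⟩) n
  exact h

/-- With a vacuous quantifier in front, a bounded formula is both `Σ⁰₁` and `Π⁰₁`. -/
theorem bounded_comprehension (hC : M.Delta1Comprehension) (p : M.Carrier → Prop)
    [IsBoundedDef (fun e => p (e 0))] : {n | p n} ∈ M.sets := by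
  have : IsBoundedDef (M := M) (fun e => (fun _ b => p b) (e 0) (e 1)) :=
    IsBoundedDef.comp (fun e => p (e 0)) (fun _ => .inl 1)
  obtain ⟨φ, E, e, hφ, hE, h⟩ := IsBoundedDef.binary (M := M) (fun _ b => p b)
  obtain ⟨X, hX, hXp⟩ := hC (.ex φ) (.all φ) ⟨φ, hφ, rfl⟩ ⟨φ, hφ, rfl⟩ E e hE fun n => by
    simp only [Sat, ← h]
    exact ⟨fun ⟨_, h⟩ _ => h, fun h => ⟨0, h 0⟩⟩
  convert hX
  ext n
  simp only [hXp, Sat, ← h, Set.mem_ofPred_eq]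
  exact ⟨fun h => ⟨0, h⟩, fun ⟨_, h⟩ => h⟩

/-! ### Arithmetic in models of `RCA₀` -/

section Arithmetic

variable [hM : Fact M.ModelsRCA0]

theorem bounded_ind (p : M.Carrier → Prop) [IsBoundedDef (fun e => p (e 0))] (zero : p 0)
    (succ : ∀ n, p n → p (n + 1)) (n : M.Carrier) : p n :=
  bounded_induction hM.out.induction p zero succ n

theorem sigma1_ind (p : M.Carrier → M.Carrier → Prop)
    [IsBoundedDef (fun e => p (e 0) (e 1))] (zero : ∃ a, p a 0)
    (succ : ∀ n, (∃ a, p a n) → ∃ a, p a (n + 1)) (n : M.Carrier) : ∃ a, p a n :=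
  sigma1_induction hM.out.induction p zero succ n

theorem bounded_comp (p : M.Carrier → Prop) [IsBoundedDef (fun e => p (e 0))] :
    {n | p n} ∈ M.sets :=
  bounded_comprehension hM.out.comprehension p

theorem basic : M.BasicAxioms := hM.out.basic

theorem num_exists_pred (n : M.Carrier) : n = 0 ∨ ∃ m, n = m + 1 := by
  obtain ⟨a, h⟩ := sigma1_ind (fun m n : M.Carrier => n = 0 ∨ n = m + 1)
    ⟨0, .inl rfl⟩ (fun n _ => ⟨n, .inr rfl⟩) n
  exact h.imp_right fun h => ⟨a, h⟩

theorem num_zero_add (n : M.Carrier) : 0 + n = n :=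
  bounded_ind (fun n : M.Carrier => 0 + n = n) (basic.add_zero 0)
    (fun n h => by rw [basic.add_succ, h]) n

theorem num_add_assoc (a b c : M.Carrier) : a + b + c = a + (b + c) :=
  bounded_ind (fun c : M.Carrier => a + b + c = a + (b + c))
    (by rw [basic.add_zero, basic.add_zero])
    (fun n h => by rw [basic.add_succ, h, basic.add_succ, basic.add_succ]) c

theorem num_succ_add (a b : M.Carrier) : a + 1 + b = a + b + 1 :=
  bounded_ind (fun b : M.Carrier => a + 1 + b = a + b + 1)
    (by rw [basic.add_zero, basic.add_zero])
    (fun n h => by rw [basic.add_succ, h, basic.add_succ]) b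

theorem num_add_comm (a b : M.Carrier) : a + b = b + a :=
  bounded_ind (fun b : M.Carrier => a + b = b + a)
    (by rw [basic.add_zero, num_zero_add])
    (fun n h => by rw [basic.add_succ, h, num_succ_add]) b

theorem num_zero_mul (n : M.Carrier) : 0 * n = 0 :=
  bounded_ind (fun n : M.Carrier => 0 * n = 0) (basic.mul_zero 0)
    (fun n h => by rw [basic.mul_succ, h, basic.add_zero]) n

theorem num_succ_mul (a b : M.Carrier) : (a + 1) * b = a * b + b :=
  bounded_ind (fun b : M.Carrier => (a + 1) * b = a * b + b)
    (by rw [basic.mul_zero, basic.mul_zero, basic.add_zero])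
    (fun n h => by
      rw [basic.mul_succ, h, basic.mul_succ, basic.add_succ _ a, basic.add_succ _ n,
        num_add_assoc _ n a, num_add_comm n a, ← num_add_assoc]) b

theorem num_mul_comm (a b : M.Carrier) : a * b = b * a :=
  bounded_ind (fun b : M.Carrier => a * b = b * a)
    (by rw [basic.mul_zero, num_zero_mul])
    (fun n h => by rw [basic.mul_succ, h, num_succ_mul]) b

theorem num_mul_add (a b c : M.Carrier) : a * (b + c) = a * b + a * c :=
  bounded_ind (fun c : M.Carrier => a * (b + c) = a * b + a * c)
    (by rw [basic.add_zero, basic.mul_zero, basic.add_zero])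
    (fun n h => by rw [basic.add_succ, basic.mul_succ, h, basic.mul_succ, num_add_assoc]) c

theorem num_mul_assoc (a b c : M.Carrier) : a * b * c = a * (b * c) :=
  bounded_ind (fun c : M.Carrier => a * b * c = a * (b * c))
    (by rw [basic.mul_zero, basic.mul_zero, basic.mul_zero])
    (fun n h => by rw [basic.mul_succ, h, basic.mul_succ, num_mul_add]) c

theorem num_mul_one (a : M.Carrier) : a * 1 = a := by
  rw [← num_zero_add (1 : M.Carrier), basic.mul_succ, basic.mul_zero, num_zero_add]

instance numCommSemiring : CommSemiring M.Carrier where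
  add_assoc := num_add_assoc
  zero_add := num_zero_add
  add_zero := basic.add_zero
  add_comm := num_add_comm
  left_distrib := num_mul_add
  right_distrib a b c := by
    rw [num_mul_comm, num_mul_add, num_mul_comm c a, num_mul_comm c b]
  zero_mul := num_zero_mul
  mul_zero := basic.mul_zero
  mul_assoc := num_mul_assoc
  one_mul a := by rw [num_mul_comm, num_mul_one]
  mul_one := num_mul_one
  mul_comm := num_mul_comm
  nsmul := nsmulRec
  npow := npowRec

/-! ### Cancellation and order -/

theorem num_add_right_cancel (a b c : M.Carrier) : a + c = b + c → a = b :=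
  bounded_ind (fun c : M.Carrier => a + c = b + c → a = b)
    (by rw [basic.add_zero, basic.add_zero]; exact id)
    (fun n h h' => by
      rw [basic.add_succ, basic.add_succ] at h'
      exact h (basic.succ_inj _ _ h')) c

/-- Reduces the order to addition. The hypothesis `m < n` is kept inside the matrix of the `Σ⁰₁`
induction, so that a witness exists, trivially, also when it fails. -/
theorem num_lt_iff (m n : M.Carrier) : m < n ↔ ∃ k, n = m + k + 1 := by
  constructor
  · intro hmn
    obtain ⟨k, hk⟩ := sigma1_ind (fun k n : M.Carrier => m < n → n = m + k + 1)
      ⟨0, fun h => (basic.not_lt_zero _ h).elim⟩ (fun n ⟨k, hk⟩ => by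
        by_cases h : m < n
        · exact ⟨k + 1, fun _ => by rw [basic.add_succ, ← hk h]⟩
        · refine ⟨0, fun h' => ?_⟩
          rw [((basic.lt_succ_iff _ _).1 h').resolve_left h, basic.add_zero]) n
    exact ⟨k, hk hmn⟩
  · rintro ⟨k, rfl⟩
    refine bounded_ind (fun k : M.Carrier => m < m + k + 1) ?_ (fun n h => ?_) k
    · rw [basic.add_zero]
      exact (basic.lt_succ_iff _ _).2 (.inr rfl)
    · rw [← num_add_assoc]
      exact (basic.lt_succ_iff _ _).2 (.inl h)

theorem num_lt_irrefl (a : M.Carrier) : ¬ a < a := by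
  rw [num_lt_iff]
  rintro ⟨k, hk⟩
  refine basic.succ_ne_zero k (num_add_right_cancel _ _ a ?_).symm
  rw [num_zero_add, num_add_comm, ← num_add_assoc, ← hk]

theorem num_lt_trans {a b c : M.Carrier} (h : a < b) (h' : b < c) : a < c := by
  rw [num_lt_iff] at *
  obtain ⟨k, rfl⟩ := h
  obtain ⟨l, rfl⟩ := h'
  exact ⟨k + 1 + l, by simp only [num_add_assoc]⟩

theorem num_trichotomy (a b : M.Carrier) : a < b ∨ a = b ∨ b < a := by
  refine bounded_ind (fun b : M.Carrier => a < b ∨ a = b ∨ b < a) ?_ (fun n h => ?_) b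
  · rcases num_exists_pred a with rfl | ⟨m, rfl⟩
    · exact .inr (.inl rfl)
    · exact .inr (.inr ((num_lt_iff _ _).2 ⟨m, by rw [num_zero_add]⟩))
  · rcases h with h | h | h
    · exact .inl ((basic.lt_succ_iff _ _).2 (.inl h))
    · exact .inl ((basic.lt_succ_iff _ _).2 (.inr h))
    · obtain ⟨k, rfl⟩ := (num_lt_iff _ _).1 h
      rcases num_exists_pred k with rfl | ⟨m, rfl⟩
      · exact .inr (.inl (by rw [basic.add_zero]))
      · refine .inr (.inr ((num_lt_iff _ _).2 ⟨m, ?_⟩))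
        rw [num_succ_add, ← num_add_assoc]

noncomputable instance numLinearOrder : LinearOrder M.Carrier where
  le a b := a < b ∨ a = b
  le_refl a := .inr rfl
  le_trans a b c := by
    rintro (h | rfl) (h' | rfl)
    · exact .inl (num_lt_trans h h')
    · exact .inl h
    · exact .inl h'
    · exact .inr rfl
  lt_iff_le_not_ge a b := by
    constructor
    · refine fun h => ⟨.inl h, ?_⟩
      rintro (h' | rfl)
      · exact num_lt_irrefl _ (num_lt_trans h h')
      · exact num_lt_irrefl _ h
    · rintro ⟨h | rfl, h'⟩
      · exact h
      · exact (h' (.inr rfl)).elim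
  le_antisymm a b := by
    rintro (h | rfl) (h' | h')
    · exact (num_lt_irrefl _ (num_lt_trans h h')).elim
    · exact h'.symm
    · rfl
    · rfl
  le_total a b := by
    rcases num_trichotomy a b with h | h | h
    · exact .inl (.inl h)
    · exact .inl (.inr h)
    · exact .inr (.inl h)
  toDecidableLE := Classical.decRel _

theorem num_lt_add_one_iff {a b : M.Carrier} : a < b + 1 ↔ a ≤ b := basic.lt_succ_iff a b

theorem num_le_iff (a b : M.Carrier) : a ≤ b ↔ ∃ k, b = a + k := by
  constructor
  · rintro (h | rfl)
    · obtain ⟨k, rfl⟩ := (num_lt_iff _ _).1 h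
      exact ⟨k + 1, num_add_assoc _ _ _⟩
    · exact ⟨0, (basic.add_zero _).symm⟩
  · rintro ⟨k, rfl⟩
    exact num_lt_add_one_iff.1 ((num_lt_iff _ _).2 ⟨k, rfl⟩)

instance numIsOrderedAddMonoid : IsOrderedAddMonoid M.Carrier where
  add_le_add_left a b h c := by
    obtain ⟨k, rfl⟩ := (num_le_iff _ _).1 h
    exact (num_le_iff _ _).2 ⟨k, add_right_comm _ _ _⟩

instance numCanonicallyOrderedAdd : CanonicallyOrderedAdd M.Carrier where
  exists_add_of_le h := (num_le_iff _ _).1 h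
  le_add_self _ b := (num_le_iff _ _).2 ⟨b, add_comm _ _⟩
  le_self_add _ b := (num_le_iff _ _).2 ⟨b, rfl⟩

instance numIsOrderedCancelAddMonoid : IsOrderedCancelAddMonoid M.Carrier where
  le_of_add_le_add_left a b c h := by
    obtain ⟨k, hk⟩ := (num_le_iff _ _).1 h
    refine (num_le_iff _ _).2 ⟨k, num_add_right_cancel _ _ a ?_⟩
    rw [add_comm, hk, add_assoc, add_comm a]

instance numIsStrictOrderedRing : IsStrictOrderedRing M.Carrier where
  zero_le_one := zero_le
  exists_pair_ne := ⟨0, 1, fun h => basic.succ_ne_zero (0 : M.Carrier) (by rw [← h, basic.add_zero])⟩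
  mul_lt_mul_of_pos_left a ha b c h := by
    obtain ⟨k, rfl⟩ := (num_lt_iff _ _).1 h
    obtain ⟨l, rfl⟩ := (num_lt_iff _ _).1 ha
    exact (num_lt_iff _ _).2 ⟨l * (k + 1) + k, by ring⟩
  mul_lt_mul_of_pos_right a ha b c h := by
    obtain ⟨k, rfl⟩ := (num_lt_iff _ _).1 h
    obtain ⟨l, rfl⟩ := (num_lt_iff _ _).1 ha
    exact (num_lt_iff _ _).2 ⟨l * (k + 1) + k, by ring⟩

/-! ### Pairing, divisibility and strong induction -/

theorem num_le_mul_self (a : M.Carrier) : a ≤ a * a := by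
  rcases num_exists_pred a with rfl | ⟨m, rfl⟩
  · simp
  · exact (num_le_iff _ _).2 ⟨m * (m + 1), by ring⟩

theorem left_le_pair (a b : M.Carrier) : a ≤ M.pair a b := le_add_self

theorem right_le_pair (a b : M.Carrier) : b ≤ M.pair a b :=
  calc b ≤ a + b := le_add_self
    _ ≤ (a + b) * (a + b) := num_le_mul_self _
    _ ≤ M.pair a b := le_self_add

/-- The code of `(a, b)` lies between `(a + b)²` and `(a + b + 1)²`, the latter excluded; hence the
code determines the sum, and then both components. -/
theorem pair_lt_pair_of_add_lt {a b c d : M.Carrier} (h : a + b < c + d) :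
    M.pair a b < M.pair c d := by
  obtain ⟨k, hk⟩ := (num_lt_iff _ _).1 h
  unfold pair
  rw [hk]
  exact (num_lt_iff _ _).2 ⟨(a + b) * (k + 1) + b + k * (k + 1) + (a + b) * k + k + c, by ring⟩

theorem pair_inj {a b c d : M.Carrier} (h : M.pair a b = M.pair c d) : a = c ∧ b = d := by
  rcases lt_trichotomy (a + b) (c + d) with h' | h' | h'
  · exact ((pair_lt_pair_of_add_lt h').ne h).elim
  · have hac : a = c := by
      unfold pair at h
      rw [h'] at h
      exact add_left_cancel h
    subst hac
    exact ⟨rfl, add_left_cancel h'⟩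
  · exact ((pair_lt_pair_of_add_lt h').ne' h).elim

instance IsBoundedDef.le (f g : (ℕ → M.Carrier) → M.Carrier) [IsTermFn f] [IsTermFn g] :
    IsBoundedDef (fun e => f e ≤ g e) :=
  inferInstanceAs (IsBoundedDef (fun e => f e < g e ∨ f e = g e))

/-- The quotient can be bounded by the dividend: this is clear for a nonzero divisor, and for
divisor `0` the quotient `0` will do. -/
instance IsBoundedDef.dvd (f g : (ℕ → M.Carrier) → M.Carrier) [IsTermFn f] [IsTermFn g] :
    IsBoundedDef (fun e => f e ∣ g e) := by
  have := IsTermFn.shift f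
  have := IsTermFn.shift g
  refine IsBoundedDef.congr (p := fun e => ∃ q, q < g e + 1 ∧ g e = f e * q) inferInstance
    fun e => ⟨fun ⟨q, _, h⟩ => ⟨q, h⟩, ?_⟩
  rintro ⟨q, h⟩
  rcases num_exists_pred (f e) with h0 | ⟨m, hm⟩
  · refine ⟨0, num_lt_add_one_iff.2 zero_le, ?_⟩
    rw [h, h0, zero_mul, zero_mul]
  · refine ⟨q, num_lt_add_one_iff.2 ?_, h⟩
    rw [h, hm]
    exact (num_le_iff _ _).2 ⟨m * q, by ring⟩

theorem strong_induction (p : M.Carrier → Prop) [IsBoundedDef (fun e => p (e 0))]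
    (h : ∀ n, (∀ m < n, p m) → p n) (n : M.Carrier) : p n := by
  have : IsBoundedDef (M := M) (fun e => ∀ m, m < e 0 → p m) :=
    have : IsBoundedDef (M := M) (fun e => (fun a _ => p a) (e 0) (fun i => e (i + 1))) := ‹_›
    IsBoundedDef.ball (fun e => e 0) (fun a _ => p a)
  refine h n (bounded_ind (fun n => ∀ m, m < n → p m) (fun m hm => ?_) (fun n ih m hm => ?_) n)
  · exact (basic.not_lt_zero _ hm).elim
  · rcases (basic.lt_succ_iff _ _).1 hm with hm | rfl
    · exact ih m hm
    · exact h m ih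

end Arithmetic

/-! ### `Σ⁰₁` comprehension -/

/-- `Σ⁰₁` comprehension. -/
def Sigma1Comprehension (M : L2Structure.{u}) : Prop :=
  ∀ p : M.Carrier → M.Carrier → Prop, IsBoundedDef (fun e => p (e 0) (e 1)) →
    {n | ∃ a, p a n} ∈ M.sets

section ArithmeticalClosure

variable [hM : Fact M.ModelsRCA0] [hS : Fact M.Sigma1Comprehension]

/-- Under `Σ⁰₁` comprehension, an existential number quantifier in front of a bounded formula can
be absorbed into a set parameter; this is done by coding the other variables, `k` of them, into
one. -/
theorem IsBoundedDef.ex_of_finite_support (k : ℕ) (p : (ℕ → M.Carrier) → Prop)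
    (hp : IsBoundedDef p)
    (hk : ∀ a e e', (∀ i < k, e i = e' i) → (p (cons a e) ↔ p (cons a e'))) :
    IsBoundedDef (fun e => ∃ a, p (cons a e)) := by
  induction k generalizing p with
  | zero =>
    refine IsBoundedDef.congr (p := fun _ => ∃ a, p (cons a fun _ => 0)) inferInstance fun e => ?_
    exact exists_congr fun a => hk a _ _ fun i hi => (Nat.not_lt_zero i hi).elim
  | succ k ih =>
    rcases k with - | k
    -- With one free variable the projection is a set of the model, and the quantified formula
    -- becomes membership in it.
    · have hX : Fact ({n | ∃ a, p (cons a fun _ => n)} ∈ M.sets) := by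
        refine ⟨hS.out (fun a n => p (cons a fun _ => n)) ?_⟩
        refine (IsBoundedDef.comp p (fun i => .inl (min i 1))).congr fun e => iff_of_eq ?_
        congr 1
        funext i
        cases i <;> simp [subst, cons]
      refine IsBoundedDef.congr (p := fun e => e 0 ∈ {n | ∃ a, p (cons a fun _ => n)})
        inferInstance fun e => exists_congr fun a => hk a _ _ fun i hi => ?_
      rw [Nat.lt_one_iff.1 hi]
    -- Variable `0` is the witness; variable `1` now holds the code of the first two free variables,
    -- so one free variable fewer remains. Both components are at most the code, which keeps the
    -- decoding bounded.
    · let q : M.Carrier → M.Carrier → (ℕ → M.Carrier) → Prop := fun y x f =>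
        f 1 = M.pair x y ∧ p (cons (f 0) (cons x (cons y fun i => f (i + 2))))
      have hq : IsBoundedDef (fun e => q (e 0) (e 1) (fun i => e (i + 2))) := by
        have : IsBoundedDef (M := M)
            (fun e => p (cons (e 2) (cons (e 1) (cons (e 0) fun i => e (i + 4))))) := by
          refine (IsBoundedDef.comp p fun i => .inl (match i with
            | 0 => 2 | 1 => 1 | 2 => 0 | i + 3 => i + 4)).congr fun e => iff_of_eq ?_
          congr 1
          funext i
          match i with
          | 0 => rfl
          | 1 => rfl
          | 2 => rfl
          | i + 3 => rfl
        exact IsBoundedDef.and (fun e => e 3 = M.pair (e 1) (e 0)) _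
      let q' : (ℕ → M.Carrier) → Prop :=
        fun f => ∃ x, x < f 1 + 1 ∧ ∃ y, y < f 1 + 1 ∧ q y x f
      have hq' : IsBoundedDef q' := by
        have : IsBoundedDef (M := M)
            (fun e => ∃ y, y < e 2 + 1 ∧ q y (e 0) (fun i => e (i + 1))) :=
          have : IsBoundedDef (M := M) (fun e => (fun y f => q y (f 0) (fun i => f (i + 1)))
            (e 0) (fun i => e (i + 1))) := hq
          IsBoundedDef.bex (fun e => e 2 + 1) (fun y f => q y (f 0) (fun i => f (i + 1)))
        exact IsBoundedDef.bex (fun e => e 1 + 1)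
          (fun x f => ∃ y, y < f 1 + 1 ∧ q y x f)
      have key : ∀ a x y f, q' (cons a (cons (M.pair x y) f)) ↔
          p (cons a (cons x (cons y f))) := by
        intro a x y f
        constructor
        · rintro ⟨x', -, y', -, h, hp⟩
          obtain ⟨rfl, rfl⟩ := pair_inj (show M.pair x y = M.pair x' y' from h)
          exact hp
        · intro hp
          exact ⟨x, num_lt_add_one_iff.2 (left_le_pair x y), y,
            num_lt_add_one_iff.2 (right_le_pair x y), rfl, hp⟩
      have hr := ih q' hq' fun a e e' he => by
        have h0 : e 0 = e' 0 := he 0 (Nat.succ_pos k)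
        refine exists_congr fun x => ?_
        show (x < e 0 + 1 ∧ _) ↔ (x < e' 0 + 1 ∧ _)
        rw [h0]
        refine and_congr_right fun _ => exists_congr fun y => ?_
        show (y < e 0 + 1 ∧ e 0 = _ ∧ p (cons a (cons x (cons y fun i => e (i + 1))))) ↔
          (y < e' 0 + 1 ∧ e' 0 = _ ∧ p (cons a (cons x (cons y fun i => e' (i + 1)))))
        rw [h0]
        refine and_congr_right fun _ => and_congr_right fun _ => hk a _ _ fun i hi => ?_
        match i with
        | 0 => rfl
        | 1 => rfl
        | i + 2 => exact he (i + 1) (by omega)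
      have hr' : IsBoundedDef (M := M) (fun e => (fun c (f : ℕ → M.Carrier) =>
          c = M.pair (f 0) (f 1) ∧ ∃ a, q' (cons a (cons c fun i => f (i + 2))))
          (e 0) (fun i => e (i + 1))) := by
        have : IsBoundedDef (M := M)
            (fun e => ∃ a, q' (cons a (cons (e 0) fun i => e (i + 3)))) := by
          refine (IsBoundedDef.comp _ (fun i => .inl (match i with
            | 0 => 0 | i + 1 => i + 3)) (hp := hr)).congr fun e =>
              exists_congr fun a => iff_of_eq ?_
          congr 2
          funext i
          cases i <;> rfl
        exact IsBoundedDef.and (fun e => e 0 = M.pair (e 1) (e 2)) _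
      -- The term `M.pair (e 0) (e 1)` is put in place of a variable by means of a bounded
      -- quantifier over its value `c`.
      refine (IsBoundedDef.bex (fun e => M.pair (e 0) (e 1) + 1) (fun c f =>
        c = M.pair (f 0) (f 1) ∧ ∃ a, q' (cons a (cons c fun i => f (i + 2))))).congr fun e => ?_
      constructor
      · rintro ⟨c, -, rfl, a, h⟩
        refine ⟨a, ?_⟩
        rw [key] at h
        rwa [← cons_eta e, ← cons_eta (fun i => e (i + 1))]
      · rintro ⟨a, h⟩
        refine ⟨_, num_lt_add_one_iff.2 le_rfl, rfl, a, (key _ _ _ _).2 ?_⟩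
        rwa [← cons_eta e, ← cons_eta (fun i => e (i + 1))] at h

instance (priority := low) IsBoundedDef.ex (q : M.Carrier → (ℕ → M.Carrier) → Prop)
    [h : IsBoundedDef (fun e => q (e 0) (fun i => e (i + 1)))] :
    IsBoundedDef (fun e => ∃ a, q a e) := by
  obtain ⟨k, hk⟩ := h.finite_support
  exact IsBoundedDef.ex_of_finite_support k _ h
    fun a e e' he => hk _ _ fun i hi => cons_agree he a i (by omega)

instance (priority := low) IsBoundedDef.all (q : M.Carrier → (ℕ → M.Carrier) → Prop)
    [IsBoundedDef (fun e => q (e 0) (fun i => e (i + 1)))] :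
    IsBoundedDef (fun e => ∀ a, q a e) :=
  IsBoundedDef.congr (p := fun e => ¬ ∃ a, ¬ q a e) inferInstance fun _ => not_exists_not

/-- Quantifier elimination at the price of new set parameters: comprehension and induction for
bounded formulas now cover all arithmetical ones. -/
theorem IsBoundedDef.sat (φ : ArithFormula) (E : ℕ → Set M.Carrier) (hE : ∀ j, E j ∈ M.sets) :
    IsBoundedDef (fun e => M.Sat E e φ) := by
  induction φ with
  | eq s t => exact ⟨.eq s t, E, .inl, .eq s t, hE, fun _ => Iff.rfl⟩
  | lt s t => exact ⟨.lt s t, E, .inl, .lt s t, hE, fun _ => Iff.rfl⟩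
  | mem t j => exact ⟨.mem t j, E, .inl, .mem t j, hE, fun _ => Iff.rfl⟩
  | neg φ h => exact IsBoundedDef.not _
  | and φ ψ h h' => exact IsBoundedDef.and _ _
  | or φ ψ h h' => exact IsBoundedDef.or _ _
  | imp φ ψ h h' => exact IsBoundedDef.imp _ _
  | iff φ ψ h h' => exact IsBoundedDef.iff _ _
  | all φ h =>
    have : IsBoundedDef (M := M) (fun e => M.Sat E (cons (e 0) fun i => e (i + 1)) φ) := by
      simpa only [cons_eta] using h
    exact IsBoundedDef.all (fun a e => M.Sat E (cons a e) φ)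
  | ex φ h =>
    have : IsBoundedDef (M := M) (fun e => M.Sat E (cons (e 0) fun i => e (i + 1)) φ) := by
      simpa only [cons_eta] using h
    exact IsBoundedDef.ex (fun a e => M.Sat E (cons a e) φ)

end ArithmeticalClosure

theorem modelsACA0_of_sigma1Comprehension (hM : M.ModelsRCA0) (hS : M.Sigma1Comprehension) :
    M.ModelsACA0 := by
  have : Fact M.ModelsRCA0 := ⟨hM⟩
  have : Fact M.Sigma1Comprehension := ⟨hS⟩
  refine ⟨hM.basic, fun X hX => ?_, fun φ E e hE => ?_⟩
  · have : Fact (X ∈ M.sets) := ⟨hX⟩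
    exact bounded_ind (fun n => n ∈ X)
  · refine ⟨{n | M.Sat E (cons n e) φ}, ?_, fun n => Iff.rfl⟩
    have : IsBoundedDef (M := M) (fun f => M.Sat E (cons (f 0) e) φ) := by
      refine ((IsBoundedDef.sat φ E hE).comp _ (fun i => match i with
        | 0 => .inl 0 | i + 1 => .inr (e i))).congr fun f => iff_of_eq ?_
      congr 1
      funext i
      cases i <;> rfl
    exact bounded_comp (fun n => M.Sat E (cons n e) φ)

theorem ArithComprehension.sigma1Comprehension (h : M.ArithComprehension) :
    M.Sigma1Comprehension := by
  intro p hp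
  obtain ⟨φ, E, e, -, hE, hφ⟩ := hp.binary p
  obtain ⟨X, hX, hXp⟩ := h (.ex φ) E e hE
  convert hX
  ext n
  simp only [hXp, Sat, ← hφ, Set.mem_ofPred_eq]

/-! ### Maximal strong antichains yield `Σ⁰₁` comprehension -/

section Reversal

variable [hM : Fact M.ModelsRCA0]

/-- The order that consists of points `(0, n)` and `(1, n)` for all `n` and `(n + 2, s)` for all
`n` and `s`; the latter lies above the two former if `p s n`, and there are no other relations. -/
def witnessOrder (p : M.Carrier → M.Carrier → Prop) : Set M.Carrier :=
  {r | ∃ x, x < r + 1 ∧ ∃ y, y < r + 1 ∧ r = M.pair x y ∧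
    (x = y ∨ ∃ n, n < x + 1 ∧ ∃ s, s < y + 1 ∧ y = M.pair (n + 1 + 1) s ∧
      (x = M.pair 0 n ∨ x = M.pair 1 n) ∧ p s n)}

/-- The bounds in `witnessOrder` serve only definability; they hold automatically, since components
never exceed their code. -/
theorem pair_mem_witnessOrder (p : M.Carrier → M.Carrier → Prop) (x y : M.Carrier) :
    M.pair x y ∈ witnessOrder p ↔ x = y ∨ ∃ n s, y = M.pair (n + 1 + 1) s ∧
      (x = M.pair 0 n ∨ x = M.pair 1 n) ∧ p s n := by
  constructor
  · rintro ⟨x', -, y', -, h, h'⟩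
    obtain ⟨rfl, rfl⟩ := pair_inj h
    refine h'.imp_right ?_
    rintro ⟨n, -, s, -, h⟩
    exact ⟨n, s, h⟩
  · intro h
    refine ⟨x, num_lt_add_one_iff.2 (left_le_pair x y), y,
      num_lt_add_one_iff.2 (right_le_pair x y), rfl, h.imp_right ?_⟩
    rintro ⟨n, s, rfl, hx, hp⟩
    refine ⟨n, num_lt_add_one_iff.2 ?_, s, num_lt_add_one_iff.2 (right_le_pair _ s), rfl, hx, hp⟩
    rcases hx with rfl | rfl
    · exact right_le_pair _ n
    · exact right_le_pair _ n

theorem witnessOrder_mem (p : M.Carrier → M.Carrier → Prop)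
    (hp : IsBoundedDef (fun e => p (e 0) (e 1))) : witnessOrder p ∈ M.sets := by
  -- Under the quantifiers below, the arguments of `p` sit at other de Bruijn positions.
  have (i j : ℕ) : IsBoundedDef (M := M) (fun e => p (e i) (e j)) :=
    (IsBoundedDef.comp _ (fun k => if k = 0 then .inl i else .inl j) (hp := hp)).congr
      fun e => Iff.rfl
  exact bounded_comp (fun r => ∃ x, x < r + 1 ∧ ∃ y, y < r + 1 ∧ r = M.pair x y ∧
    (x = y ∨ ∃ n, n < x + 1 ∧ ∃ s, s < y + 1 ∧ y = M.pair (n + 1 + 1) s ∧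
      (x = M.pair 0 n ∨ x = M.pair 1 n) ∧ p s n))

theorem zero_ne_add_two (n : M.Carrier) : (0 : M.Carrier) ≠ n + 1 + 1 :=
  fun h => basic.succ_ne_zero _ h.symm

theorem one_ne_add_two (n : M.Carrier) : (1 : M.Carrier) ≠ n + 1 + 1 :=
  fun h => basic.succ_ne_zero n (add_right_cancel ((zero_add (1 : M.Carrier)).trans h)).symm

/-- No point of the lower level is in the upper level. -/
theorem lower_ne_upper {x n m s : M.Carrier} (hx : x = M.pair 0 n ∨ x = M.pair 1 n) :
    x ≠ M.pair (m + 1 + 1) s := by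
  rintro rfl
  rcases hx with h | h
  · exact zero_ne_add_two m (pair_inj h).1.symm
  · exact one_ne_add_two m (pair_inj h).1.symm

/-- The order has only two levels, so two strict relations never compose. -/
theorem witnessOrder_isPartialOrder (p : M.Carrier → M.Carrier → Prop)
    (hp : IsBoundedDef (fun e => p (e 0) (e 1))) :
    M.IsPartialOrder Set.univ (witnessOrder p) where
  carrier_mem := by
    convert bounded_comp (M := M) (fun n => n = n)
    simp
  rel_mem := witnessOrder_mem p hp
  rel_sub := by
    rintro c ⟨x, -, y, -, h, -⟩
    exact ⟨x, trivial, y, trivial, h⟩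
  refl x _ := (pair_mem_witnessOrder p x x).2 (.inl rfl)
  antisymm x _ y _ h h' := by
    rw [pair_mem_witnessOrder] at h h'
    rcases h with h | ⟨n, s, hy, -, -⟩
    · exact h
    rcases h' with h' | ⟨m, t, -, hy', -⟩
    · exact h'.symm
    · exact (lower_ne_upper hy' hy).elim
  trans x _ y _ z _ h h' := by
    rw [pair_mem_witnessOrder] at h h' ⊢
    rcases h with rfl | ⟨n, s, hy, hx, hp⟩
    · exact h'
    rcases h' with rfl | ⟨m, t, -, hy', -⟩
    · exact .inr ⟨n, s, hy, hx, hp⟩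
    · exact (lower_ne_upper hy' hy).elim

/-- A witness gives the two points for `n` a common upper bound, so `B` omits one of them. Without a
witness both points are comparable only to themselves, and maximality puts them in `B`. -/
theorem exists_witness_iff {p : M.Carrier → M.Carrier → Prop} {B : Set M.Carrier}
    (hB : M.IsMaximalStrongAntichain Set.univ (witnessOrder p) B) (n : M.Carrier) :
    (∃ s, p s n) ↔ ¬ (M.pair 0 n ∈ B ∧ M.pair 1 n ∈ B) := by
  constructor
  · rintro ⟨s, hs⟩ ⟨h0, h1⟩
    have := hB.isStrongAntichain.incompatible _ h0 _ h1 (M.pair (n + 1 + 1) s) trivial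
      ((pair_mem_witnessOrder p _ _).2 (.inr ⟨n, s, rfl, .inl rfl, hs⟩))
      ((pair_mem_witnessOrder p _ _).2 (.inr ⟨n, s, rfl, .inr rfl, hs⟩))
    exact zero_ne_one (pair_inj this).1
  · intro h
    by_contra hn
    have isolated : ∀ x, (x = M.pair 0 n ∨ x = M.pair 1 n) → ∀ z,
        M.pair x z ∈ witnessOrder p → x = z := by
      intro x hx z hz
      rcases (pair_mem_witnessOrder p x z).1 hz with h | ⟨m, s, -, hx', hp⟩
      · exact h
      · refine (hn ⟨s, ?_⟩).elim
        have : n = m := by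
          rcases hx with rfl | rfl <;> rcases hx' with h | h <;> exact (pair_inj h).2
        rwa [this]
    have below : ∀ x, (x = M.pair 0 n ∨ x = M.pair 1 n) → ∀ y,
        M.pair y x ∈ witnessOrder p → y = x := by
      intro x hx y hy
      rcases (pair_mem_witnessOrder p y x).1 hy with h | ⟨m, s, h, -⟩
      · exact h
      · exact (lower_ne_upper hx h).elim
    have mem : ∀ x, (x = M.pair 0 n ∨ x = M.pair 1 n) → x ∈ B := by
      intro x hx
      have : Fact (B ∈ M.sets) := ⟨hB.isStrongAntichain.mem_sets⟩
      have hBx : M.IsStrongAntichain Set.univ (witnessOrder p) {y | y ∈ B ∨ y = x} := by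
        refine ⟨bounded_comp (fun y => y ∈ B ∨ y = x), fun _ _ => trivial, ?_⟩
        rintro y (hy | rfl) y' (hy' | rfl) z hz h h'
        · exact hB.isStrongAntichain.incompatible y hy y' hy' z hz h h'
        · obtain rfl := isolated _ hx z h'
          exact below _ hx y h
        · obtain rfl := isolated _ hx z h
          exact (below _ hx y' h').symm
        · rfl
      rw [← hB.maximal _ hBx fun y hy => .inl hy]
      exact .inr rfl
    exact h ⟨mem _ (.inl rfl), mem _ (.inr rfl)⟩

theorem MaximalStrongAntichainExistence.sigma1Comprehension
    (h : M.MaximalStrongAntichainExistence) : M.Sigma1Comprehension := by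
  intro p hp
  obtain ⟨B, hB⟩ := h _ _ (witnessOrder_isPartialOrder p hp)
  have : Fact (B ∈ M.sets) := ⟨hB.isStrongAntichain.mem_sets⟩
  simp only [exists_witness_iff hB]
  exact bounded_comp fun n => ¬ (M.pair 0 n ∈ B ∧ M.pair 1 n ∈ B)

end Reversal

/-! ### Coding of initial segments of sets -/

section Coding

variable [hM : Fact M.ModelsRCA0]

/-- In the absence of subtraction the two quotients are compared; if that of the sum is not the
larger one, then `y = 0`. -/
theorem num_dvd_of_dvd_add {u x y : M.Carrier} (hx : u ∣ x) (hxy : u ∣ x + y) : u ∣ y := by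
  obtain ⟨r, rfl⟩ := hx
  obtain ⟨s, hs⟩ := hxy
  rcases le_total r s with h | h
  · obtain ⟨t, rfl⟩ := (num_le_iff _ _).1 h
    exact ⟨t, add_left_cancel (hs.trans (mul_add u r t))⟩
  · obtain ⟨t, rfl⟩ := (num_le_iff _ _).1 h
    have h0 : u * t + y = 0 := add_left_cancel (a := u * s) (by
      rw [add_zero]
      exact Eq.trans (by ring) hs)
    rw [(add_eq_zero.1 h0).2]
    exact dvd_zero u

/-- The witness is a factorial, built up by `Σ⁰₁` induction. -/
theorem exists_common_multiple (n : M.Carrier) : ∃ d, 0 < d ∧ ∀ m, m < n → m + 1 ∣ d := by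
  refine sigma1_ind (fun d n : M.Carrier => 0 < d ∧ ∀ m, m < n → m + 1 ∣ d) ?_ ?_ n
  · exact ⟨1, zero_lt_one, fun m hm => (basic.not_lt_zero m hm).elim⟩
  · rintro n ⟨d, hd, h⟩
    refine ⟨d * (n + 1), mul_pos hd (num_lt_add_one_iff.2 zero_le), fun m hm => ?_⟩
    rcases (basic.lt_succ_iff _ _).1 hm with hm | rfl
    · exact (h m hm).mul_right _
    · exact dvd_mul_left _ _

theorem num_dvd_of_dvd_mul {a d c : M.Carrier} (h : 1 + a * d ∣ d * c) : 1 + a * d ∣ c := by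
  refine num_dvd_of_dvd_add (h.mul_left a) ?_
  rw [show a * (d * c) + c = (1 + a * d) * c by ring]
  exact dvd_mul_right _ _

/-- If `d` is a common multiple of `1, …, n`, then the numbers `1 + (m + 1) d` with `m < n` are
pairwise coprime. -/
theorem num_coprime {n d k m c : M.Carrier} (hd : ∀ m, m < n → m + 1 ∣ d) (hk : k < n) (hm : m < n)
    (hkm : k ≠ m) (h : 1 + (k + 1) * d ∣ (1 + (m + 1) * d) * c) : 1 + (k + 1) * d ∣ c := by
  -- Two moduli differ by `(j + 1) * d`, where `j + 1` is the distance of their indices and so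
  -- divides `d`. Both factors can be cancelled because the modulus is coprime to `d`.
  have cancel : ∀ j, j < n → 1 + (k + 1) * d ∣ d * ((j + 1) * c) → 1 + (k + 1) * d ∣ c := by
    intro j hj hdvd
    obtain ⟨q, hq⟩ := hd j hj
    refine num_dvd_of_dvd_mul ?_
    have := (num_dvd_of_dvd_mul hdvd).mul_left q
    rwa [show q * ((j + 1) * c) = (j + 1) * q * c by ring, ← hq] at this
  rcases lt_or_gt_of_ne hkm with hlt | hlt
  · obtain ⟨j, rfl⟩ := (num_lt_iff _ _).1 hlt
    refine cancel j (lt_of_le_of_lt ?_ hm) (num_dvd_of_dvd_add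
      (x := (1 + (k + 1) * d) * c) (dvd_mul_right _ _) ?_)
    · exact (num_le_iff _ _).2 ⟨k + 1, by ring⟩
    · convert h using 1
      ring
  · obtain ⟨j, rfl⟩ := (num_lt_iff _ _).1 hlt
    refine cancel j (lt_of_le_of_lt ?_ hk) (num_dvd_of_dvd_add h ?_)
    · exact (num_le_iff _ _).2 ⟨m + 1, by ring⟩
    · exact ⟨c, by ring⟩

theorem num_not_dvd_one {a d : M.Carrier} (hd : 0 < d) : ¬ 1 + (a + 1) * d ∣ 1 := by
  rintro ⟨q, hq⟩
  rcases num_exists_pred q with rfl | ⟨q, rfl⟩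
  · rw [mul_zero] at hq
    exact one_ne_zero hq
  · have h0 : (a + 1) * d + (1 + (a + 1) * d) * q = 0 :=
      add_left_cancel (a := (1 : M.Carrier)) (by rw [add_zero]; exact Eq.trans (by ring) hq.symm)
    exact (mul_pos (num_lt_add_one_iff.2 zero_le) hd).ne' (add_eq_zero.1 h0).1

/-! ### Codes of greedily built sets -/

/-- `c` codes, by divisibility by the numbers `1 + (m + 1) d`, the part below `n` of the subset of
`Q` that is built greedily by avoiding the pairs in `K`. -/
def IsGreedyCode (Q K : Set M.Carrier) (n d c : M.Carrier) : Prop :=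
  ∀ m, m < n → (1 + (m + 1) * d ∣ c ↔
    m ∈ Q ∧ ∀ k, k < m → 1 + (k + 1) * d ∣ c → M.pair k m ∉ K)

variable {Q K : Set M.Carrier}

/-- The greedy condition at `m` refers only to smaller numbers, so strong induction shows that codes
with different `d` and `c` decide alike. -/
theorem IsGreedyCode.agree {n d c n' d' c' : M.Carrier} (h : IsGreedyCode Q K n d c)
    (h' : IsGreedyCode Q K n' d' c') (m : M.Carrier) (hm : m < n) (hm' : m < n') :
    1 + (m + 1) * d ∣ c ↔ 1 + (m + 1) * d' ∣ c' := by
  revert hm hm'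
  refine strong_induction (fun m => m < n → m < n' → (1 + (m + 1) * d ∣ c ↔
    1 + (m + 1) * d' ∣ c')) (fun m ih hm hm' => ?_) m
  rw [h m hm, h' m hm']
  refine and_congr_right fun _ => forall_congr' fun k => imp_congr_right fun hk => ?_
  rw [ih k hk (hk.trans hm) (hk.trans hm')]

variable (Q K) [hQ : Fact (Q ∈ M.sets)] [hK : Fact (K ∈ M.sets)]

theorem exists_isGreedyCode (n : M.Carrier) : ∃ d c, IsGreedyCode Q K n d c := by
  obtain ⟨d, hd0, hd⟩ := exists_common_multiple n
  refine ⟨d, ?_⟩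
  -- Stage `j`: the code is right below `j` and contains nothing from `j` up to `n`. As `d` is fixed
  -- beforehand, only `c` is existentially quantified. The initial code is `1`; accepting `j`
  -- multiplies `c` by the modulus of `j`, which by coprimality changes no other decision.
  let p : M.Carrier → M.Carrier → Prop := fun c j => ∀ m, m < n → (1 + (m + 1) * d ∣ c ↔
    m < j ∧ (m ∈ Q ∧ ∀ k, k < m → 1 + (k + 1) * d ∣ c → M.pair k m ∉ K))
  have : IsBoundedDef (M := M) (fun e => p (e 0) (e 1)) :=
    inferInstanceAs (IsBoundedDef (M := M) (fun e => ∀ m, m < n → (1 + (m + 1) * d ∣ e 0 ↔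
    m < e 1 ∧ (m ∈ Q ∧ ∀ k, k < m → 1 + (k + 1) * d ∣ e 0 → M.pair k m ∉ K))))
  obtain ⟨c, hc⟩ := sigma1_ind p
    ⟨1, fun m _ => iff_of_false (num_not_dvd_one hd0) fun h => basic.not_lt_zero _ h.1⟩ (by
      rintro j ⟨c, hc⟩
      by_cases hj : j < n ∧ j ∈ Q ∧ ∀ k, k < j → 1 + (k + 1) * d ∣ c → M.pair k j ∉ K
      · obtain ⟨hjn, hj⟩ := hj
        have hdvd : ∀ m, m < n →
            (1 + (m + 1) * d ∣ (1 + (j + 1) * d) * c ↔ m = j ∨ 1 + (m + 1) * d ∣ c) := by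
          intro m hm
          constructor
          · intro h
            by_cases hmj : m = j
            · exact .inl hmj
            · exact .inr (num_coprime hd hm hjn hmj h)
          · rintro (rfl | h)
            · exact dvd_mul_right _ _
            · exact h.mul_left _
        refine ⟨(1 + (j + 1) * d) * c, fun m hm => ?_⟩
        have hbelow : m ≤ j → ((∀ k, k < m → 1 + (k + 1) * d ∣ (1 + (j + 1) * d) * c →
            M.pair k m ∉ K) ↔ ∀ k, k < m → 1 + (k + 1) * d ∣ c → M.pair k m ∉ K) := by
          refine fun hmj => forall_congr' fun k => imp_congr_right fun hk => ?_
          rw [hdvd k (hk.trans hm), or_iff_right (hk.trans_le hmj).ne]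
        rw [hdvd m hm]
        rcases lt_trichotomy m j with h | rfl | h
        · rw [hbelow h.le, or_iff_right h.ne, hc m hm, and_iff_right h,
            and_iff_right (num_lt_add_one_iff.2 h.le)]
        · rw [hbelow le_rfl]
          exact iff_of_true (.inl rfl) ⟨num_lt_add_one_iff.2 le_rfl, hj⟩
        · rw [or_iff_right h.ne', hc m hm]
          exact iff_of_false (fun h' => h'.1.not_gt h)
            fun h' => (num_lt_add_one_iff.1 h'.1).not_gt h
      · refine ⟨c, fun m hm => ?_⟩
        rw [hc m hm]
        refine ⟨fun h => ⟨num_lt_add_one_iff.2 h.1.le, h.2⟩, fun h => ⟨?_, h.2⟩⟩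
        rcases (basic.lt_succ_iff _ _).1 h.1 with h' | rfl
        · exact h'
        · exact (hj ⟨hm, h.2⟩).elim) n
  exact ⟨c, fun m hm => by rw [hc m hm, and_iff_right hm]⟩

variable [hS : Fact M.Sigma1Comprehension]

/-- Under `Σ⁰₁` comprehension, greedy constructions can be carried out. -/
theorem exists_greedy_set : ∃ B ∈ M.sets, ∀ m, m ∈ B ↔
    m ∈ Q ∧ ∀ k, k < m → k ∈ B → M.pair k m ∉ K := by
  -- A number is in the set if some correct code reaching past it accepts it. By agreement of codes,
  -- one code for `m + 1` decides all numbers up to `m`.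
  refine ⟨_, bounded_comp (fun n => ∃ d c, (∀ m, m < n + 1 → (1 + (m + 1) * d ∣ c ↔
    m ∈ Q ∧ ∀ k, k < m → 1 + (k + 1) * d ∣ c → M.pair k m ∉ K)) ∧ 1 + (n + 1) * d ∣ c),
    fun m => ?_⟩
  obtain ⟨d, c, hc⟩ := exists_isGreedyCode Q K (m + 1)
  have hmem : ∀ k, k ≤ m → ((∃ d c, IsGreedyCode Q K (k + 1) d c ∧ 1 + (k + 1) * d ∣ c) ↔
      1 + (k + 1) * d ∣ c) := by
    intro k hk
    constructor
    · rintro ⟨d', c', hc', h⟩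
      exact (hc.agree hc' k (num_lt_add_one_iff.2 hk) (num_lt_add_one_iff.2 le_rfl)).2 h
    · intro h
      exact ⟨d, c, fun l hl => hc l (hl.trans_le (add_le_add_left hk 1)), h⟩
  refine (hmem m le_rfl).trans ((hc m (num_lt_add_one_iff.2 le_rfl)).trans ?_)
  refine and_congr_right fun _ => forall_congr' fun k => imp_congr_right fun hk => ?_
  exact imp_congr_left (hmem k hk.le).symm

end Coding

/-! ### Extending strong antichains -/

/-- `Q` holds the candidates, incompatible with all of `A`, and `K` the compatible pairs. For
maximality, a point outside `A` of a strong antichain containing the union is a candidate and is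
incompatible with every smaller accepted point, so it was accepted itself. -/
theorem Sigma1Comprehension.strongAntichainExtension (hM : M.ModelsRCA0)
    (hS : M.Sigma1Comprehension) : M.StrongAntichainExtension := by
  intro P R hPR A hA
  have : Fact M.ModelsRCA0 := ⟨hM⟩
  have : Fact M.Sigma1Comprehension := ⟨hS⟩
  have : Fact (P ∈ M.sets) := ⟨hPR.carrier_mem⟩
  have : Fact (R ∈ M.sets) := ⟨hPR.rel_mem⟩
  have : Fact (A ∈ M.sets) := ⟨hA.mem_sets⟩
  let Q : Set M.Carrier :=
    {x | x ∈ P ∧ ∀ a, a ∈ A → ∀ z, z ∈ P → M.pair a z ∈ R → M.pair x z ∉ R}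
  let K : Set M.Carrier :=
    {c | ∃ x y, c = M.pair x y ∧ ∃ z, z ∈ P ∧ M.pair x z ∈ R ∧ M.pair y z ∈ R}
  have hQ : Fact (Q ∈ M.sets) := ⟨bounded_comp fun x =>
    x ∈ P ∧ ∀ a, a ∈ A → ∀ z, z ∈ P → M.pair a z ∈ R → M.pair x z ∉ R⟩
  have hK : Fact (K ∈ M.sets) := ⟨bounded_comp fun c =>
    ∃ x y, c = M.pair x y ∧ ∃ z, z ∈ P ∧ M.pair x z ∈ R ∧ M.pair y z ∈ R⟩
  have mem_K : ∀ x y, M.pair x y ∈ K ↔ ∃ z, z ∈ P ∧ M.pair x z ∈ R ∧ M.pair y z ∈ R := by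
    intro x y
    constructor
    · rintro ⟨x', y', h, hz⟩
      obtain ⟨rfl, rfl⟩ := pair_inj h
      exact hz
    · exact fun h => ⟨x, y, rfl, h⟩
  obtain ⟨B, hB, mem_B⟩ := exists_greedy_set Q K
  have : Fact (B ∈ M.sets) := ⟨hB⟩
  have incompatible : ∀ x ∈ B, ∀ y ∈ B, x < y → ∀ z ∈ P, M.pair x z ∈ R → M.pair y z ∉ R :=
    fun x hx y hy hxy z hz h h' =>
      ((mem_B y).1 hy).2 x hxy hx ((mem_K x y).2 ⟨z, hz, h, h'⟩)
  have hAB : M.IsStrongAntichain P R {x | x ∈ A ∨ x ∈ B} := by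
    refine ⟨bounded_comp fun x => x ∈ A ∨ x ∈ B, ?_, ?_⟩
    · rintro x (hx | hx)
      · exact hA.subset hx
      · exact ((mem_B x).1 hx).1.1
    · rintro x (hx | hx) y (hy | hy) z hz h h'
      · exact hA.incompatible x hx y hy z hz h h'
      · exact (((mem_B y).1 hy).1.2 x hx z hz h h').elim
      · exact (((mem_B x).1 hx).1.2 y hy z hz h' h).elim
      · rcases lt_trichotomy x y with hxy | hxy | hxy
        · exact (incompatible x hx y hy hxy z hz h h').elim
        · exact hxy
        · exact (incompatible y hy x hx hxy z hz h' h).elim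
  refine ⟨_, fun x hx => .inl hx, hAB, fun C hC hsub => (Set.Subset.antisymm hsub ?_).symm⟩
  intro x hx
  by_cases hxA : x ∈ A
  · exact .inl hxA
  refine .inr ((mem_B x).2 ⟨⟨hC.subset hx, fun a ha z hz h h' => hxA ?_⟩,
    fun k hk hkB hkx => hk.ne ?_⟩)
  · rwa [← hC.incompatible a (hsub (.inl ha)) x hx z hz h h']
  · obtain ⟨z, hz, h, h'⟩ := (mem_K k x).1 hkx
    exact hC.incompatible k (hsub (.inr hkB)) x hx z hz h h'

theorem StrongAntichainExtension.existence (hM : M.ModelsRCA0) (h : M.StrongAntichainExtension) :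
    M.MaximalStrongAntichainExistence := by
  intro P R hPR
  have hempty : M.IsStrongAntichain P R {_n | False} :=
    ⟨bounded_comprehension hM.comprehension fun _ => False, fun _ h => h.elim,
      fun _ h => h.elim⟩
  obtain ⟨B, -, hB⟩ := h P R hPR _ hempty
  exact ⟨B, hB⟩

end L2Structure
end SecondOrderArithmetic

/-- The three statements are equivalent over `RCA₀`, that is, in every model of `RCA₀`. -/
theorem lemma4p3 (M : SecondOrderArithmetic.L2Structure.{u}) (hM : M.ModelsRCA0) :
    [M.ModelsACA0, M.StrongAntichainExtension, M.MaximalStrongAntichainExistence].TFAE := by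
  have : Fact M.ModelsRCA0 := ⟨hM⟩
  tfae_have 1 → 2 := fun h => h.comprehension.sigma1Comprehension.strongAntichainExtension hM
  tfae_have 2 → 3 := fun h => h.existence hM
  tfae_have 3 → 1 := fun h =>
    SecondOrderArithmetic.L2Structure.modelsACA0_of_sigma1Comprehension hM h.sigma1Comprehension
  tfae_finish
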